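/- **Model.** Consider a two-player non-zero-sum semi-Markov game with finite discrete state space $S$ and Borel action spaces $A$, $B$ (Borel subsets of Polish spaces). For $i\in S$, $A(i)\subset A$ and $B(i)\subset B$ are the Borel sets of admissible actions, and $\mathbb K=\{(i,a,b): i\in S,\ a\in A(i),\ b\in B(i)\}$. For $(i,a,b)\in\mathbb K$, let $p_{i,\cdot}(a,b)$ be the transition law on $S$, $F_{i,a,b}$ the sojourn time distribution, with $F_{i,a,b}(0)=0$, and $\rho^m_{(i,a,b)}:[0,\infty)\to\mathbb R$ the running cost of player $m=1,2$. Write $X_n$ for the $n$-th state, $A_n,B_n$ for the actions chosen there and $S_n$ for the sojourn time there. A stationary policy of player 1 is a stochastic kernel $\phi^1$ on $A$ given $S$ with $\phi^1(A(i)\mid i)=1$ for all $i$, and similarly $\phi^2$ on $B$ for player 2. A discrete-time policy $\pi^m=(\pi^m_n)_{n\ge0}$ of player $m$ consists of stochastic kernels $\pi^m_n$, concentrated on the actions of player $m$ admissible in state $X_n$, which depend only on $X_0,A_0,B_0,\dots,X_{n-1},A_{n-1},B_{n-1},X_n$ (and not on the sojourn times). Let $\mathbb E_i^{\pi^1,\pi^2}$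 be the expectation for the process $(X_n,A_n,B_n,S_n)_{n\ge0}$ with $X_0=i$, in which, given the past, $A_n$ and $B_n$ are drawn independently from $\pi^1_n$ and $\pi^2_n$, $S_n$ has distribution $F_{X_n,A_n,B_n}$ and $X_{n+1}$ has law $p_{X_n,\cdot}(A_n,B_n)$. **Assumption 1.** (i) $A(i)$ and $B(i)$ are compact for every $i$. (ii) $(a,b)\mapsto p_{i,j}(a,b)$ is continuous on $A(i)\times B(i)$ for all $i,j$. (iii) There is $T>0$ with $F_{i,a,b}(T)=1$ on $\mathbb K$, and for every $i$ and every bounded measurable $u$ the map $(a,b)\mapsto\int u\,dF_{i,a,b}$ is continuous on $A(i)\times B(i)$. (iv) With the same $T$, for every $i$ and $m=1,2$, $(a,b,s)\mapsto\rho^m_{(i,a,b)}(s)$ is continuous on $A(i)\times B(i)\times[0,T]$. **Assumption 2.** Under every pair of stationary policies the embedded Markov chain $(X_n)$ is irreducible. For $\theta>0$ and a bounded continuous function $D:\mathbb K\to\mathbb R$ put $$V_{\theta,D}(i,\pi^1,\pi^2)=\limsup_{n\to\infty}\frac1{\theta n}\ln\mathbb E_i^{\pi^1,\pi^2}\Big[e^{\theta\sum_{k=0}^{n-1}D(X_k,A_k,B_k)}\Big].$$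 **Theorem.** Suppose Assumptions 1 and 2 hold. Let $\theta>0$, let $D_1,D_2$ be bounded continuous functions on $\mathbb K$, and fix a pair of stationary policies $(\phi^1,\phi^2)$. Then there exist functions $y^{\phi^1},y^{\phi^2}:S\to\mathbb R$ and constants $\mu^{\phi^1},\mu^{\phi^2}\in\mathbb R$ such that the following hold. (i) For all $i\in S$, $$e^{\theta y^{\phi^2}(i)+\theta\mu^{\phi^2}}=\inf_{\psi\in\mathcal P(A(i))}\int_{A(i)}\int_{B(i)}e^{\theta D_1(i,a,b)}\sum_{j\in S}e^{\theta y^{\phi^2}(j)}p_{i,j}(a,b)\,\phi^2(db\mid i)\,\psi(da),$$ and for all $i\in S$, $\mu^{\phi^2}=\inf_{\pi^1}V_{\theta,D_1}(i,\pi^1,\phi^2)$. (ii) For all $i\in S$, $$e^{\theta y^{\phi^1}(i)+\theta\mu^{\phi^1}}=\inf_{\varphi\in\mathcal P(B(i))}\int_{A(i)}\int_{B(i)}e^{\theta D_2(i,a,b)}\sum_{j\in S}e^{\theta y^{\phi^1}(j)}p_{i,j}(a,b)\,\varphi(db)\,\phi^1(da\mid i),$$ and for all $i\in S$, $\mu^{\phi^1}=\inf_{\pi^2}V_{\theta,D_2}(i,\phi^1,\pi^2)$.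 Here $\mathcal P(E)$ is the set of Borel probability measures on $E$, and the infima over $\pi^1$ and $\pi^2$ run over all discrete-time policies of player 1 and of player 2. -/

import Mathlib

open MeasureTheory ProbabilityTheory Filter
open scoped NNReal ENNReal BoundedContinuousFunction

noncomputable section

/-- The set `𝕂 = {(i,a,b) : a ∈ A(i), b ∈ B(i)}` of admissible state-action triples, with the
topology and the σ-algebra induced by `S × A × B`. -/
abbrev AdmissibleTriple {S A B : Type*} (actA : S → Set A) (actB : S → Set B) : Type _ :=
  {k : S × A × B // k.2.1 ∈ actA k.1 ∧ k.2.2 ∈ actB k.1}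

/-- The data of a two-player non-zero-sum semi-Markov game with state space `S` and action
spaces `A`, `B`: admissible actions, transition law, sojourn time law and running costs. -/
structure SemiMarkovGame (S A B : Type*) [MeasurableSpace S] [MeasurableSpace A]
    [MeasurableSpace B] where
  /-- admissible actions of player 1 -/
  actA : S → Set A
  /-- admissible actions of player 2 -/
  actB : S → Set B
  measurableSet_actA : ∀ i, MeasurableSet (actA i)
  measurableSet_actB : ∀ i, MeasurableSet (actB i)
  /-- the controlled transition law: `p (i,a,b) {j}` is `p_{i,j}(a,b)` -/
  p : Kernel (AdmissibleTriple actA actB) S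
  isMarkovKernel_p : IsMarkovKernel p
  /-- the sojourn time law; sojourn times are positive, so it is a law on `(0,∞)` -/
  F : Kernel (AdmissibleTriple actA actB) (Set.Ioi (0 : ℝ))
  isMarkovKernel_F : IsMarkovKernel F
  /-- running cost of player 1 -/
  ρ₁ : AdmissibleTriple actA actB → ℝ≥0 → ℝ
  /-- running cost of player 2 -/
  ρ₂ : AdmissibleTriple actA actB → ℝ≥0 → ℝ

/-- A randomized history-dependent policy of a player whose actions lie in `E`, the admissible
ones in state `i` being `act i`. The history up to the `n`-th transition consists of the triples
`(X_k, A_k, B_k) ∈ K` and sojourn times `S_k`, `k < n`, and of the current state `X_n`. -/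
structure Policy (K : Type*) {S E : Type*} [MeasurableSpace K] [MeasurableSpace S]
    [MeasurableSpace E] (act : S → Set E) where
  ker : ∀ n : ℕ, Kernel ((Fin n → K × Set.Ioi (0 : ℝ)) × S) E
  isMarkovKernel_ker : ∀ n, IsMarkovKernel (ker n)
  ker_act : ∀ n h, ker n h (act h.2) = 1

/-- The policy does not use the sojourn times: the `n`-th kernel depends only on
`X_0, A_0, B_0, …, X_{n-1}, A_{n-1}, B_{n-1}, X_n`. -/
def Policy.IsDiscreteTime {K S E : Type*} [MeasurableSpace K] [MeasurableSpace S]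
    [MeasurableSpace E] {act : S → Set E} (π : Policy K act) : Prop :=
  ∀ (n : ℕ) (h h' : (Fin n → K × Set.Ioi (0 : ℝ)) × S),
    (∀ k, (h.1 k).1 = (h'.1 k).1) → h.2 = h'.2 → π.ker n h = π.ker n h'

/-- A stationary policy: a stochastic kernel from `S` to `E` with `φ(act i | i) = 1`. -/
structure StationaryPolicy {S E : Type*} [MeasurableSpace S] [MeasurableSpace E]
    (act : S → Set E) where
  ker : Kernel S E
  isMarkovKernel_ker : IsMarkovKernel ker
  ker_act : ∀ i, ker i (act i) = 1

/-- `φ(· | i)` as a measure on the set of actions admissible in state `i`. -/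
def StationaryPolicy.on {S E : Type*} [MeasurableSpace S] [MeasurableSpace E]
    {act : S → Set E} (φ : StationaryPolicy act) (i : S) : Measure (act i) :=
  (φ.ker i).comap Subtype.val

/-- A stationary policy as a policy: it always uses `φ(· | X_n)`. -/
def StationaryPolicy.toPolicy {S E : Type*} [MeasurableSpace S] [MeasurableSpace E]
    {act : S → Set E} (φ : StationaryPolicy act) (K : Type*) [MeasurableSpace K] :
    Policy K act where
  ker _ := φ.ker.comap Prod.snd measurable_snd
  isMarkovKernel_ker _ := by
    have := φ.isMarkovKernel_ker
    infer_instance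
  ker_act _ h := φ.ker_act h.2

namespace SemiMarkovGame

section Basic

variable {S A B : Type*} [MeasurableSpace S] [MeasurableSpace A] [MeasurableSpace B]

/-- The set `𝕂` of the game. -/
abbrev K (M : SemiMarkovGame S A B) : Type _ := AdmissibleTriple M.actA M.actB

/-- The element `(i,a,b)` of `𝕂`. -/
def triple (M : SemiMarkovGame S A B) (i : S) (a : M.actA i) (b : M.actB i) : M.K :=
  ⟨(i, a.1, b.1), a.2, b.2⟩

/-- `p_{i,j}(a,b)` for `k = (i,a,b)`. -/
def prob (M : SemiMarkovGame S A B) (k : M.K) (j : S) : ℝ := (M.p k).real {j}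

/-- Policies of player 1. -/
abbrev Policy₁ (M : SemiMarkovGame S A B) : Type _ := Policy M.K M.actA

/-- Policies of player 2. -/
abbrev Policy₂ (M : SemiMarkovGame S A B) : Type _ := Policy M.K M.actB

/-- Stationary policies of player 1. -/
abbrev Stationary₁ (M : SemiMarkovGame S A B) : Type _ := StationaryPolicy M.actA

/-- Stationary policies of player 2. -/
abbrev Stationary₂ (M : SemiMarkovGame S A B) : Type _ := StationaryPolicy M.actB

/-- One stage of the process: `(X_n, A_n, B_n, S_n)`. -/
abbrev Stage (M : SemiMarkovGame S A B) : Type _ := M.K × Set.Ioi (0 : ℝ)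

/-- The history space `H_n`. -/
abbrev Hist (M : SemiMarkovGame S A B) (n : ℕ) : Type _ := (Fin n → M.Stage) × S

/-- The stages `0, …, n` as the past part of a history up to transition `n + 1`. -/
def past (M : SemiMarkovGame S A B) (n : ℕ) (x : (k : Finset.Iic n) → M.Stage) :
    Fin (n + 1) → M.Stage :=
  fun k => x ⟨k.1, Finset.mem_Iic.2 (Nat.lt_succ_iff.1 k.2)⟩

theorem measurable_past (M : SemiMarkovGame S A B) (n : ℕ) : Measurable (M.past n) :=
  measurable_pi_lambda _ fun _ => measurable_pi_apply _

/-- The transition matrix of the embedded chain under a pair of stationary policies. -/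
def transitionMatrix (M : SemiMarkovGame S A B) (φ₁ : M.Stationary₁) (φ₂ : M.Stationary₂) :
    Matrix S S ℝ :=
  fun i j => ∫ a, ∫ b, M.prob (M.triple i a b) j ∂(φ₂.on i) ∂(φ₁.on i)

/-- Irreducibility assumption: the embedded chain is irreducible under each pair of stationary policies. -/
def EmbeddedIrreducible (M : SemiMarkovGame S A B) : Prop :=
  ∀ (φ₁ : M.Stationary₁) (φ₂ : M.Stationary₂), (M.transitionMatrix φ₁ φ₂).IsIrreducible

end Basic

/-- The compactness-continuity assumption. Since `S` is discrete, continuity on `𝕂` is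
continuity in `(a,b) ∈ A(i) × B(i)` for each `i`. -/
structure CompactContinuous {S A B : Type*} [TopologicalSpace S] [MeasurableSpace S]
    [TopologicalSpace A] [MeasurableSpace A] [TopologicalSpace B] [MeasurableSpace B]
    (M : SemiMarkovGame S A B) : Prop where
  isCompact_actA : ∀ i, IsCompact (M.actA i)
  isCompact_actB : ∀ i, IsCompact (M.actB i)
  continuous_prob : ∀ j, Continuous fun k : M.K => M.prob k j
  continuous_sojourn : ∀ u : ℝ → ℝ, Measurable u → (∃ c, ∀ s, |u s| ≤ c) →
    Continuous fun k : M.K => ∫ s, u s ∂(M.F k)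
  /-- a common bound `T` for the sojourn times, and continuity of the costs up to time `T` -/
  exists_bound : ∃ T : ℝ≥0, 0 < T ∧ (∀ k : M.K, M.F k {s | (s : ℝ) ≤ T} = 1) ∧
    ContinuousOn (fun q : M.K × ℝ≥0 => M.ρ₁ q.1 q.2) {q | q.2 ≤ T} ∧
    ContinuousOn (fun q : M.K × ℝ≥0 => M.ρ₂ q.1 q.2) {q | q.2 ≤ T}

section ProcessLaw

variable {S A B : Type*} [Finite S] [MeasurableSpace S] [MeasurableSingletonClass S]
  [MeasurableSpace A] [MeasurableSpace B]

theorem measurableSet_admissible (M : SemiMarkovGame S A B) :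
    MeasurableSet {k : S × A × B | k.2.1 ∈ M.actA k.1 ∧ k.2.2 ∈ M.actB k.1} := by
  have h : {k : S × A × B | k.2.1 ∈ M.actA k.1 ∧ k.2.2 ∈ M.actB k.1} =
      ⋃ i : S, ({i} : Set S) ×ˢ (M.actA i ×ˢ M.actB i) := by
    ext ⟨i, a, b⟩
    simp
  rw [h]
  exact MeasurableSet.iUnion fun i => (measurableSet_singleton i).prod
    ((M.measurableSet_actA i).prod (M.measurableSet_actB i))

theorem measurableEmbedding_val (M : SemiMarkovGame S A B) :
    MeasurableEmbedding (Subtype.val : M.K → S × A × B) :=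
  MeasurableEmbedding.subtype_coe M.measurableSet_admissible

/-- The law of `(X_n, A_n, B_n)` given the history up to the `n`-th transition: the players
choose their actions independently, according to `π₁` and `π₂`. -/
def actionKernel (M : SemiMarkovGame S A B) (π₁ : M.Policy₁) (π₂ : M.Policy₂) (n : ℕ) :
    Kernel (M.Hist n) M.K :=
  (Kernel.deterministic (Prod.snd : M.Hist n → S) measurable_snd ×ₖ
    (π₁.ker n ×ₖ π₂.ker n)).comapRight M.measurableEmbedding_val

instance (M : SemiMarkovGame S A B) (π₁ : M.Policy₁) (π₂ : M.Policy₂) (n : ℕ) :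
    IsMarkovKernel (M.actionKernel π₁ π₂ n) := by
  have := π₁.isMarkovKernel_ker n
  have := π₂.isMarkovKernel_ker n
  refine Kernel.IsMarkovKernel.comapRight _ _ fun h => ?_
  have hm := M.measurableSet_admissible
  rw [Subtype.range_coe_subtype]
  refine le_antisymm prob_le_one ?_
  calc (1 : ℝ≥0∞) = (Kernel.deterministic (Prod.snd : M.Hist n → S) measurable_snd ×ₖ
      (π₁.ker n ×ₖ π₂.ker n)) h (({h.2} : Set S) ×ˢ (M.actA h.2 ×ˢ M.actB h.2)) := by
        rw [Kernel.prod_apply, Measure.prod_prod, Kernel.prod_apply, Measure.prod_prod,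
          π₁.ker_act, π₂.ker_act, Kernel.deterministic_apply,
          Measure.dirac_apply' _ (measurableSet_singleton _)]
        simp
    _ ≤ _ := measure_mono (by
        rintro ⟨i, a, b⟩ ⟨hi, ha, hb⟩
        simp only [Set.mem_singleton_iff] at hi
        subst hi
        exact ⟨ha, hb⟩)

/-- The law of `(X_n, A_n, B_n, S_n)` given the history: the sojourn time has law
`F (X_n, A_n, B_n)`. -/
def stageKernel (M : SemiMarkovGame S A B) (π₁ : M.Policy₁) (π₂ : M.Policy₂) (n : ℕ) :
    Kernel (M.Hist n) M.Stage :=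
  M.actionKernel π₁ π₂ n ⊗ₖ M.F.prodMkLeft (M.Hist n)

instance (M : SemiMarkovGame S A B) (π₁ : M.Policy₁) (π₂ : M.Policy₂) (n : ℕ) :
    IsMarkovKernel (M.stageKernel π₁ π₂ n) := by
  have := M.isMarkovKernel_F
  unfold stageKernel
  infer_instance

/-- The law of `X_{n+1}` given stages `0, …, n` is `p (X_n, A_n, B_n)`. -/
def nextState (M : SemiMarkovGame S A B) (n : ℕ) : Kernel ((k : Finset.Iic n) → M.Stage) S :=
  M.p.comap (fun x => (x ⟨n, Finset.mem_Iic.2 le_rfl⟩).1)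
    (measurable_fst.comp (measurable_pi_apply _))

/-- The law of stage `n + 1` given stages `0, …, n`: first `X_{n+1}` is drawn, then the actions
and the sojourn time. -/
def stepKernel (M : SemiMarkovGame S A B) (π₁ : M.Policy₁) (π₂ : M.Policy₂) (n : ℕ) :
    Kernel ((k : Finset.Iic n) → M.Stage) M.Stage :=
  M.stageKernel π₁ π₂ (n + 1) ∘ₖ
    (Kernel.deterministic (M.past n) (M.measurable_past n) ×ₖ M.nextState n)

instance (M : SemiMarkovGame S A B) (π₁ : M.Policy₁) (π₂ : M.Policy₂) (n : ℕ) :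
    IsMarkovKernel (M.stepKernel π₁ π₂ n) := by
  have := M.isMarkovKernel_p
  unfold stepKernel nextState
  infer_instance

/-- The law of the process `(X_n, A_n, B_n, S_n)_{n ≥ 0}` started at `X_0 = i`, under the
policies `π₁`, `π₂` (Ionescu-Tulcea). -/
def law (M : SemiMarkovGame S A B) (i : S) (π₁ : M.Policy₁) (π₂ : M.Policy₂) :
    Measure (ℕ → M.Stage) :=
  Kernel.trajMeasure (X := fun _ => M.Stage) (M.stageKernel π₁ π₂ 0 (Fin.elim0, i))
    (M.stepKernel π₁ π₂)

/-- The discrete-time risk-sensitive average cost `V_{θ,D}(i, π₁, π₂)`. -/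
def avgCost (M : SemiMarkovGame S A B) (θ : ℝ) (D : M.K → ℝ) (i : S)
    (π₁ : M.Policy₁) (π₂ : M.Policy₂) : EReal :=
  limsup (fun n : ℕ => ((1 / (θ * n) * Real.log
    (∫ ω, Real.exp (θ * ∑ k ∈ Finset.range n, D (ω k).1) ∂(M.law i π₁ π₂)) : ℝ) : EReal)) atTop

end ProcessLaw

end SemiMarkovGame

end

/-! Put `x = exp (θ y)` and `l = exp (θ μ)`. Once the opponent's stationary policy is integrated
out, the equation for one player reads `l * x i = min_a ∑ j, q i a j * x j`, where `q i a j` is the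
average of `exp (θ D) * p_{ij}` over the opponent's action. This is an eigenvalue problem for a
minimum of nonnegative matrices whose rows are chosen independently from compact sets. Averaging
over a randomized action gives nothing below the minimum over pure actions, and a Dirac mass attains
it.

Each choice `g` of one action per state gives an irreducible matrix, since the weight `exp (θ D)` is
bounded away from zero. `exists_pos_eigenvector_min` minimizes `l` over all `(g, x, l)` with `x` in
the simplex and `Q_g x ≤ l x`. At a minimizer `x` is positive, and no strict inequality can occur:
irreducibility would spread it to all coordinates (`Matrix.IsIrreducible.exists_mulVec_lt`), and `l`
could be lowered. Applied to `g` this gives the eigenvector equation; applied to `g` with one row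
changed, it gives optimality of `g`.

The value is identified by verification. The one-step inequality `l x ≤ ...` holds at every history
whatever the controller does, so by induction the expected product of `n` weights, with terminal
factor `x`, is at least `l ^ n * x i`. As `x` lies between positive constants, dropping it does not
change the exponential growth rate, so the cost is at least `log l / θ` (`log_div_le_avgCost`).
Playing `g` reverses the inequality (`avgCost_le_log_div`). -/

/-! ### Irreducible nonnegative matrices and a Perron problem for row-wise minima. -/

section Perron

open Matrix

variable {S : Type*} [Fintype S]

theorem Matrix.mulVec_le_mulVec_of_nonneg {Q : Matrix S S ℝ} (hQ : ∀ i j, 0 ≤ Q i j) {x y : S → ℝ}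
    (h : ∀ i, x i ≤ y i) (i : S) : (Q *ᵥ x) i ≤ (Q *ᵥ y) i :=
  Finset.sum_le_sum fun j _ => mul_le_mul_of_nonneg_left (h j) (hQ i j)

theorem Matrix.pow_mulVec_le [DecidableEq S] {Q : Matrix S S ℝ} (hQ : ∀ i j, 0 ≤ Q i j)
    {x : S → ℝ} {l : ℝ} (hl : 0 ≤ l) (h : ∀ i, (Q *ᵥ x) i ≤ l * x i) (k : ℕ) (i : S) :
    ((Q ^ k) *ᵥ x) i ≤ l ^ k * x i := by
  induction k generalizing i with
  | zero => simp
  | succ k ih =>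
    rw [pow_succ', ← Matrix.mulVec_mulVec]
    calc (Q *ᵥ ((Q ^ k) *ᵥ x)) i ≤ (Q *ᵥ (l ^ k • x)) i :=
          Matrix.mulVec_le_mulVec_of_nonneg hQ (fun j => by simpa using ih j) i
      _ = l ^ k * (Q *ᵥ x) i := by simp [Matrix.mulVec_smul]
      _ ≤ l ^ k * (l * x i) := mul_le_mul_of_nonneg_left (h i) (pow_nonneg hl k)
      _ = l ^ (k + 1) * x i := by ring

/-- A nonzero nonnegative subinvariant vector of an irreducible matrix is positive. -/
theorem Matrix.IsIrreducible.pos_of_mulVec_le {Q : Matrix S S ℝ} (hQ : Q.IsIrreducible)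
    {x : S → ℝ} {l : ℝ} (hl : 0 ≤ l) (hx : ∀ i, 0 ≤ x i) {j : S} (hj : 0 < x j)
    (h : ∀ i, (Q *ᵥ x) i ≤ l * x i) : 0 < l ∧ ∀ i, 0 < x i := by
  classical
  have key : ∀ i, ∃ k > 0, 0 < l ^ k * x i := fun i => by
    obtain ⟨k, hk, hkp⟩ := (Matrix.isIrreducible_iff_exists_pow_pos hQ.nonneg).1 hQ i j
    -- With `(Q ^ k) i j > 0`, the chain `0 < (Q ^ k) i j * x j ≤ (Q ^ k x) i ≤ l ^ k * x i` gives
    -- both claims; `k > 0` is what excludes `l = 0`.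
    refine ⟨k, hk, lt_of_lt_of_le ?_ (Matrix.pow_mulVec_le hQ.nonneg hl h k i)⟩
    exact lt_of_lt_of_le (mul_pos hkp hj) (Finset.single_le_sum
      (f := fun m => (Q ^ k) i m * x m)
      (fun m _ => mul_nonneg (Matrix.pow_apply_nonneg hQ.nonneg k i m) (hx m))
      (Finset.mem_univ j))
  constructor
  · obtain ⟨k, hk, hp⟩ := key j
    rcases hl.eq_or_lt with rfl | h0
    · rw [zero_pow hk.ne', zero_mul] at hp
      exact absurd hp (lt_irrefl _)
    · exact h0
  · intro i
    obtain ⟨k, -, hp⟩ := key i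
    exact pos_of_mul_pos_right hp (pow_nonneg hl k)

/-- A subinvariant vector of an irreducible matrix that is not invariant can be improved to a
strictly subinvariant one. -/
theorem Matrix.IsIrreducible.exists_mulVec_lt {Q : Matrix S S ℝ} (hQ : Q.IsIrreducible)
    {x : S → ℝ} {l : ℝ} (hx : ∀ i, 0 ≤ x i)
    (h : ∀ i, (Q *ᵥ x) i ≤ l * x i) {i₀ : S} (h₀ : (Q *ᵥ x) i₀ < l * x i₀) :
    ∃ z : S → ℝ, (∀ i, 0 < z i) ∧ ∀ i, (Q *ᵥ z) i < l * z i := by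
  classical
  choose k hk hkp using (Matrix.isIrreducible_iff_exists_pow_pos hQ.nonneg).1 hQ
  obtain ⟨N, hN⟩ : ∃ N, ∀ i, k i i₀ < N :=
    ⟨(Finset.univ.sup fun i => k i i₀) + 1,
      fun i => Nat.lt_succ_of_le (Finset.le_sup (f := fun i => k i i₀) (Finset.mem_univ i))⟩
  -- The range is long enough that column `i₀` of `R` is positive, so `R` carries the strict
  -- inequality at `i₀` to every coordinate. As a polynomial in `Q` it commutes with `Q`, whence `Q
  -- (R x) = R (Q x) < l R x`.
  set R : Matrix S S ℝ := ∑ m ∈ Finset.range N, Q ^ m with hR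
  have hR0 : ∀ i j, 0 ≤ R i j := fun i j => by
    rw [hR, Matrix.sum_apply]
    exact Finset.sum_nonneg fun m _ => Matrix.pow_apply_nonneg hQ.nonneg m i j
  have hRpos : ∀ i, 0 < R i i₀ := fun i => by
    rw [hR, Matrix.sum_apply]
    exact lt_of_lt_of_le (hkp i i₀) (Finset.single_le_sum (f := fun m => (Q ^ m) i i₀)
      (fun m _ => Matrix.pow_apply_nonneg hQ.nonneg m i i₀) (Finset.mem_range.2 (hN i)))
  have hcomm : Q * R = R * Q := by
    rw [hR, Finset.mul_sum, Finset.sum_mul]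
    exact Finset.sum_congr rfl fun m _ => (Commute.self_pow Q m).eq
  have hz : ∀ i, (Q *ᵥ (R *ᵥ x)) i < l * (R *ᵥ x) i := fun i => by
    rw [Matrix.mulVec_mulVec, hcomm, ← Matrix.mulVec_mulVec]
    have : l * (R *ᵥ x) i = ∑ j, R i j * (l * x j) := by
      simp only [Matrix.mulVec, dotProduct, Finset.mul_sum]
      exact Finset.sum_congr rfl fun j _ => by ring
    rw [this]
    exact Finset.sum_lt_sum (fun j _ => mul_le_mul_of_nonneg_left (h j) (hR0 i j))
      ⟨i₀, Finset.mem_univ _, mul_lt_mul_of_pos_left h₀ (hRpos i)⟩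
  have hRx : ∀ i, 0 ≤ (R *ᵥ x) i := fun i =>
    Finset.sum_nonneg fun j _ => mul_nonneg (hR0 i j) (hx j)
  refine ⟨R *ᵥ x, fun i => ?_, hz⟩
  -- A zero coordinate of `R x` would force `(Q (R x)) i < 0`.
  refine lt_of_le_of_ne (hRx i) fun h0 => ?_
  have h1 := hz i
  rw [← h0, mul_zero] at h1
  exact absurd h1 (not_lt.2 (Finset.sum_nonneg fun j _ => mul_nonneg (hQ.nonneg i j) (hRx j)))

/-- The domination passes to powers as `c ^ k * P ^ k ≤ Q ^ k`. It transfers irreducibility from the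
embedded chain to the matrix weighted by `exp (θ D)`. -/
theorem Matrix.IsIrreducible.of_smul_le {P Q : Matrix S S ℝ} (hP : P.IsIrreducible) {c : ℝ}
    (hc : 0 < c) (h : ∀ i j, c * P i j ≤ Q i j) : Q.IsIrreducible := by
  classical
  have hQ : ∀ i j, 0 ≤ Q i j := fun i j => (mul_nonneg hc.le (hP.nonneg i j)).trans (h i j)
  rw [Matrix.isIrreducible_iff_exists_pow_pos hQ]
  intro i j
  obtain ⟨k, hk, hkp⟩ := (Matrix.isIrreducible_iff_exists_pow_pos hP.nonneg).1 hP i j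
  have key : ∀ (k : ℕ) (i j : S), c ^ k * (P ^ k) i j ≤ (Q ^ k) i j := fun k => by
    induction k with
    | zero => simp
    | succ k ih =>
      intro i j
      rw [pow_succ P, pow_succ Q, Matrix.mul_apply, Matrix.mul_apply, Finset.mul_sum]
      refine Finset.sum_le_sum fun m _ => ?_
      calc c ^ (k + 1) * ((P ^ k) i m * P m j) = (c ^ k * (P ^ k) i m) * (c * P m j) := by ring
        _ ≤ (Q ^ k) i m * Q m j := mul_le_mul (ih i m) (h m j)
            (mul_nonneg hc.le (hP.nonneg m j)) (Matrix.pow_apply_nonneg hQ k i m)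
  exact ⟨k, hk, lt_of_lt_of_le (mul_pos (pow_pos hc k) hkp) (key k i j)⟩

/-- The Perron eigenvalue problem for a minimum of irreducible nonnegative matrices whose rows
range independently over compact families. -/
theorem exists_pos_eigenvector_min [Nonempty S] {X : S → Type*} [∀ i, TopologicalSpace (X i)]
    [∀ i, CompactSpace (X i)] [∀ i, Nonempty (X i)] (q : ∀ i, X i → S → ℝ)
    (hq : ∀ i j, Continuous fun a => q i a j)
    (hirr : ∀ g : ∀ i, X i, (Matrix.of fun i j => q i (g i) j).IsIrreducible) :
    ∃ (x : S → ℝ) (l : ℝ) (g : ∀ i, X i), (∀ i, 0 < x i) ∧ 0 < l ∧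
      (∀ i, ∑ j, q i (g i) j * x j = l * x i) ∧ ∀ i a, l * x i ≤ ∑ j, q i a j * x j := by
  classical
  -- Every single row occurs in one of the irreducible matrices.
  have hq0 : ∀ i a j, 0 ≤ q i a j := fun i a j => by
    obtain ⟨g⟩ : Nonempty (∀ i, X i) := inferInstance
    simpa using (hirr (Function.update g i a)).nonneg i j
  -- a normalized form of feasibility
  have norm : ∀ (z : S → ℝ) (g : ∀ i, X i) (l : ℝ), (∀ i, 0 < z i) →
      (∀ i, ∑ j, q i (g i) j * z j ≤ l * z i) →
      ∃ z' ∈ stdSimplex ℝ S, ∀ i, ∑ j, q i (g i) j * z' j ≤ l * z' i := by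
    intro z g l hz h
    have hs : 0 < ∑ j, z j := Finset.sum_pos (fun j _ => hz j) Finset.univ_nonempty
    refine ⟨fun i => z i / ∑ j, z j, ⟨fun i => (div_pos (hz i) hs).le, ?_⟩, fun i => ?_⟩
    · rw [← Finset.sum_div, div_self hs.ne']
    · have := div_le_div_of_nonneg_right (h i) hs.le
      rw [Finset.sum_div] at this
      simpa only [mul_div_assoc] using this
  obtain ⟨g₀⟩ : Nonempty (∀ i, X i) := inferInstance
  -- The total mass of one matrix bounds all its row sums, so the constant vector is feasible with
  -- `l = L`. This makes the feasible set nonempty and allows `l` to be confined to `[0, L]`.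
  set L : ℝ := ∑ i, ∑ j, q i (g₀ i) j with hL
  have hL0 : 0 ≤ L := Finset.sum_nonneg fun i _ => Finset.sum_nonneg fun j _ => hq0 _ _ _
  obtain ⟨z₀, hz₀, hz₀'⟩ := norm (fun _ => 1) g₀ L (fun _ => one_pos) (fun i => by
    simp only [mul_one]
    exact Finset.single_le_sum (f := fun i => ∑ j, q i (g₀ i) j)
      (fun i _ => Finset.sum_nonneg fun j _ => hq0 _ _ _) (Finset.mem_univ i))
  set C : Set ((∀ i, X i) × (S → ℝ) × ℝ) :=
    (Set.univ ×ˢ (stdSimplex ℝ S ×ˢ Set.Icc 0 L)) ∩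
      {w | ∀ i, ∑ j, q i (w.1 i) j * w.2.1 j ≤ w.2.2 * w.2.1 i} with hC
  have hcomp : IsCompact C := by
    refine (isCompact_univ.prod ((isCompact_stdSimplex ℝ S).prod isCompact_Icc)).inter_right ?_
    rw [Set.ofPred_forall]
    refine isClosed_iInter fun i => isClosed_le ?_ (by fun_prop)
    refine continuous_finsetSum _ fun j _ => Continuous.mul ?_ (by fun_prop)
    exact (hq i j).comp (by fun_prop)
  obtain ⟨⟨g, x, l⟩, hmem, hmin⟩ := hcomp.exists_isMinOn
    ⟨(g₀, z₀, L), ⟨trivial, hz₀, hL0, le_rfl⟩, hz₀'⟩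
    (f := fun w => w.2.2) (by fun_prop)
  obtain ⟨⟨-, hx, hl0, hlL⟩, hfeas⟩ := hmem
  simp only at hx hl0 hlL
  change ∀ i, ∑ j, q i (g i) j * x j ≤ l * x i at hfeas
  obtain ⟨j₀, hj₀⟩ : ∃ j, 0 < x j := by
    by_contra! hcon
    have : ∑ j, x j ≤ 0 := Finset.sum_nonpos fun j _ => hcon j
    rw [hx.2] at this
    exact absurd this (by norm_num)
  obtain ⟨hl, hxpos⟩ := (hirr g).pos_of_mulVec_le hl0 hx.1 hj₀ hfeas
  -- The selector `g'` is arbitrary because the claim is needed both for the minimizer `g` and for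
  -- its one-row modifications. A strict inequality yields a positive `z` that is strict everywhere;
  -- the largest ratio `(Q z) i / z i` is then a feasible value below `l`.
  have key : ∀ g' : ∀ i, X i, (∀ i, ∑ j, q i (g' i) j * x j ≤ l * x i) →
      ∀ i, ¬ ∑ j, q i (g' i) j * x j < l * x i := by
    intro g' hg' i₀ h₀
    obtain ⟨z, hz, hlt⟩ := (hirr g').exists_mulVec_lt hx.1 hg' h₀
    change ∀ i, ∑ j, q i (g' i) j * z j < l * z i at hlt
    set l' := Finset.univ.sup' Finset.univ_nonempty fun i => (∑ j, q i (g' i) j * z j) / z i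
    have hl' : l' < l := (Finset.sup'_lt_iff _).2 fun i _ => (div_lt_iff₀ (hz i)).2 (hlt i)
    have hle : ∀ i, ∑ j, q i (g' i) j * z j ≤ l' * z i := fun i =>
      (div_le_iff₀ (hz i)).1 (Finset.le_sup'
        (f := fun i => (∑ j, q i (g' i) j * z j) / z i) (Finset.mem_univ i))
    have hl'0 : 0 ≤ l' := le_trans
      (div_nonneg (Finset.sum_nonneg fun j _ => mul_nonneg (hq0 _ _ _) (hz j).le) (hz i₀).le)
      (Finset.le_sup' (f := fun i => (∑ j, q i (g' i) j * z j) / z i) (Finset.mem_univ i₀))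
    obtain ⟨z', hz', hle'⟩ := norm z g' l' hz hle
    have := hmin (a := (g', z', l'))
      ⟨⟨trivial, hz', hl'0, hl'.le.trans hlL⟩, hle'⟩
    exact absurd this (not_le.2 hl')
  refine ⟨x, l, g, hxpos, hl, fun i => (hfeas i).antisymm (not_lt.1 (key g hfeas i)), ?_⟩
  intro i a
  by_contra! hlt
  -- If action `a` did better in state `i`, changing only that row would keep feasibility and be
  -- strict at `i`.
  refine key (Function.update g i a) (fun m => ?_) i (by simpa using hlt)
  rcases eq_or_ne m i with rfl | hm
  · simpa using hlt.le
  · simpa [hm] using hfeas m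

end Perron

/-! ### Multiplicative expectations under the law of the process. -/

namespace SemiMarkovGame

section Reward

variable {S A B : Type*} [Finite S] [MeasurableSpace S] [MeasurableSingletonClass S]
  [MeasurableSpace A] [MeasurableSpace B] (M : SemiMarkovGame S A B)

instance (i : S) (π₁ : M.Policy₁) (π₂ : M.Policy₂) : IsProbabilityMeasure (M.law i π₁ π₂) := by
  unfold law
  infer_instance

theorem lintegral_law_succ (i : S) (π₁ : M.Policy₁) (π₂ : M.Policy₂) (n : ℕ)
    {f : ((k : Finset.Iic n) → M.Stage) × M.Stage → ℝ≥0∞} (hf : Measurable f) :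
    ∫⁻ ω, f (Preorder.frestrictLe n ω, ω (n + 1)) ∂(M.law i π₁ π₂) =
      ∫⁻ ω, ∫⁻ s, f (Preorder.frestrictLe n ω, s)
        ∂(M.stepKernel π₁ π₂ n (Preorder.frestrictLe n ω)) ∂(M.law i π₁ π₂) := by
  have h := Kernel.map_frestrictLe_trajMeasure_compProd_eq_map_trajMeasure
    (X := fun _ => M.Stage) (μ₀ := M.stageKernel π₁ π₂ 0 (Fin.elim0, i))
    (κ := M.stepKernel π₁ π₂) (a := n)
  change (M.law i π₁ π₂).map _ ⊗ₘ _ = (M.law i π₁ π₂).map _ at h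
  have hm : Measurable fun ω : ℕ → M.Stage => (Preorder.frestrictLe (π := fun _ => M.Stage) n ω,
    ω (n + 1)) := by fun_prop
  rw [← lintegral_map hf hm, ← h, Measure.lintegral_compProd hf,
    lintegral_map (Measurable.lintegral_kernel_prod_right' hf) (by fun_prop)]

theorem map_law_zero (i : S) (π₁ : M.Policy₁) (π₂ : M.Policy₂) :
    (M.law i π₁ π₂).map (fun ω => ω 0) = M.stageKernel π₁ π₂ 0 (Fin.elim0, i) := by
  have h0 : (fun ω : ℕ → M.Stage => ω 0) =
      (fun x : (k : Finset.Iic 0) → M.Stage => x ⟨0, Finset.mem_Iic.2 le_rfl⟩) ∘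
        Preorder.frestrictLe (π := fun _ => M.Stage) 0 := rfl
  rw [h0, ← Measure.map_map (by fun_prop) (by fun_prop)]
  unfold law Kernel.trajMeasure
  rw [Measure.map_comp _ _ (by fun_prop), Kernel.traj_map_frestrictLe, Kernel.partialTraj_self,
    Measure.id_comp, Measure.map_map (by fun_prop) (by fun_prop)]
  exact Measure.map_id

theorem lintegral_stageKernel (π₁ : M.Policy₁) (π₂ : M.Policy₂) (n : ℕ) (h : M.Hist n)
    {f : M.K → ℝ≥0∞} (hf : Measurable f) :
    ∫⁻ s, f s.1 ∂(M.stageKernel π₁ π₂ n h) = ∫⁻ k, f k ∂(M.actionKernel π₁ π₂ n h) := by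
  have := M.isMarkovKernel_F
  unfold stageKernel
  have hf' : Measurable fun s : M.Stage => f s.1 := hf.comp measurable_fst
  rw [Kernel.lintegral_compProd _ _ _ hf']
  simp

/-- The multiplicative reward of the stages `0, …, n`, together with the expected terminal reward
`ξ` of the state after stage `n`. -/
noncomputable def multReward (e : M.K → ℝ≥0∞) (ξ : S → ℝ≥0∞) (n : ℕ) (ω : ℕ → M.Stage) : ℝ≥0∞ :=
  (∏ k ∈ Finset.range (n + 1), e (ω k).1) * ∫⁻ j, ξ j ∂(M.p (ω n).1)

theorem lintegral_multReward_zero (i : S) (π₁ : M.Policy₁) (π₂ : M.Policy₂) {e : M.K → ℝ≥0∞}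
    (he : Measurable e) (ξ : S → ℝ≥0∞) :
    ∫⁻ ω, M.multReward e ξ 0 ω ∂(M.law i π₁ π₂) =
      ∫⁻ k, e k * ∫⁻ j, ξ j ∂(M.p k) ∂(M.actionKernel π₁ π₂ 0 (Fin.elim0, i)) := by
  have hG : Measurable fun k => e k * ∫⁻ j, ξ j ∂(M.p k) :=
    he.mul (measurable_of_finite ξ).lintegral_kernel
  have hG' : Measurable fun s : M.Stage => e s.1 * ∫⁻ j, ξ j ∂(M.p s.1) := hG.comp measurable_fst
  rw [← M.lintegral_stageKernel π₁ π₂ 0 _ hG, ← M.map_law_zero,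
    lintegral_map hG' (by fun_prop)]
  simp [multReward]

/-- Conditioning on stages `0, …, n` pulls out their product; the last stage is drawn by first
sampling the next state, then the actions. The sojourn time integrates to one. -/
theorem lintegral_multReward_succ (i : S) (π₁ : M.Policy₁) (π₂ : M.Policy₂) {e : M.K → ℝ≥0∞}
    (he : Measurable e) (ξ : S → ℝ≥0∞) (n : ℕ) :
    ∫⁻ ω, M.multReward e ξ (n + 1) ω ∂(M.law i π₁ π₂) =
      ∫⁻ ω, (∏ k ∈ Finset.range (n + 1), e (ω k).1) *
        ∫⁻ j, ∫⁻ k, e k * ∫⁻ j, ξ j ∂(M.p k) ∂(M.actionKernel π₁ π₂ (n + 1)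
          (M.past n (Preorder.frestrictLe n ω), j)) ∂(M.p (ω n).1) ∂(M.law i π₁ π₂) := by
  have hp := M.isMarkovKernel_p
  have hG : Measurable fun k => e k * ∫⁻ j, ξ j ∂(M.p k) :=
    he.mul (measurable_of_finite ξ).lintegral_kernel
  have hG' : Measurable fun s : M.Stage => e s.1 * ∫⁻ j, ξ j ∂(M.p s.1) := hG.comp measurable_fst
  set P : ((k : Finset.Iic n) → M.Stage) → ℝ≥0∞ := fun x =>
    ∏ k : Fin (n + 1), e (M.past n x k).1 with hP
  have hPm : Measurable P := Finset.measurable_fun_prod _ fun k _ =>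
    he.comp (measurable_fst.comp ((measurable_pi_apply k).comp (M.measurable_past n)))
  have hPω : ∀ ω : ℕ → M.Stage, P (Preorder.frestrictLe n ω) =
      ∏ k ∈ Finset.range (n + 1), e (ω k).1 := fun ω => by
    rw [Finset.prod_range]
    rfl
  have h := M.lintegral_law_succ i π₁ π₂ n
    (f := fun q => P q.1 * (e q.2.1 * ∫⁻ j, ξ j ∂(M.p q.2.1)))
    ((hPm.comp measurable_fst).mul (hG.comp (measurable_fst.comp measurable_snd)))
  simp only [hPω] at h
  simp only [multReward, Finset.prod_range_succ _ (n + 1), mul_assoc]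
  rw [h]
  refine lintegral_congr fun ω => ?_
  rw [lintegral_const_mul _ hG']
  congr 1
  unfold stepKernel nextState
  rw [Kernel.lintegral_comp _ _ _ hG',
    Kernel.lintegral_deterministic_prod _ _ _ (Measurable.lintegral_kernel hG'),
    Kernel.lintegral_comap]
  exact lintegral_congr fun j => M.lintegral_stageKernel π₁ π₂ (n + 1) _ hG

/-- The one-step bound is assumed at every history, so it can be applied inside the conditional
expectation and iterated for history-dependent policies. The exponent `n + 1` counts the stages `0,
…, n`. -/
theorem le_lintegral_multReward (i : S) (π₁ : M.Policy₁) (π₂ : M.Policy₂) {e : M.K → ℝ≥0∞}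
    (he : Measurable e) (ξ : S → ℝ≥0∞) {l : ℝ≥0∞}
    (h : ∀ n (h : M.Hist n),
      l * ξ h.2 ≤ ∫⁻ k, e k * ∫⁻ j, ξ j ∂(M.p k) ∂(M.actionKernel π₁ π₂ n h)) (n : ℕ) :
    l ^ (n + 1) * ξ i ≤ ∫⁻ ω, M.multReward e ξ n ω ∂(M.law i π₁ π₂) := by
  induction n with
  | zero =>
    rw [M.lintegral_multReward_zero i π₁ π₂ he, zero_add, pow_one]
    exact h 0 (Fin.elim0, i)
  | succ n ih =>
    have hm : Measurable (M.multReward e ξ n) :=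
      (Finset.measurable_fun_prod _ fun k _ => by fun_prop).mul
        ((measurable_of_finite ξ).lintegral_kernel.comp (by fun_prop))
    rw [M.lintegral_multReward_succ i π₁ π₂ he]
    calc l ^ (n + 1 + 1) * ξ i = l * (l ^ (n + 1) * ξ i) := by ring
      _ ≤ l * ∫⁻ ω, M.multReward e ξ n ω ∂(M.law i π₁ π₂) := by gcongr
      _ = ∫⁻ ω, l * M.multReward e ξ n ω ∂(M.law i π₁ π₂) := (lintegral_const_mul _ hm).symm
      _ ≤ _ := lintegral_mono fun ω => by
        rw [multReward, mul_left_comm, ← lintegral_const_mul _ (measurable_of_finite ξ)]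
        gcongr with j
        exact h (n + 1) (M.past n (Preorder.frestrictLe n ω), j)

theorem lintegral_multReward_le (i : S) (π₁ : M.Policy₁) (π₂ : M.Policy₂) {e : M.K → ℝ≥0∞}
    (he : Measurable e) (ξ : S → ℝ≥0∞) {l : ℝ≥0∞}
    (h : ∀ n (h : M.Hist n),
      ∫⁻ k, e k * ∫⁻ j, ξ j ∂(M.p k) ∂(M.actionKernel π₁ π₂ n h) ≤ l * ξ h.2) (n : ℕ) :
    ∫⁻ ω, M.multReward e ξ n ω ∂(M.law i π₁ π₂) ≤ l ^ (n + 1) * ξ i := by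
  induction n with
  | zero =>
    rw [M.lintegral_multReward_zero i π₁ π₂ he, zero_add, pow_one]
    exact h 0 (Fin.elim0, i)
  | succ n ih =>
    have hm : Measurable (M.multReward e ξ n) :=
      (Finset.measurable_fun_prod _ fun k _ => by fun_prop).mul
        ((measurable_of_finite ξ).lintegral_kernel.comp (by fun_prop))
    rw [M.lintegral_multReward_succ i π₁ π₂ he]
    calc _ ≤ ∫⁻ ω, l * M.multReward e ξ n ω ∂(M.law i π₁ π₂) := lintegral_mono fun ω => by
          rw [multReward, mul_left_comm, ← lintegral_const_mul _ (measurable_of_finite ξ)]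
          gcongr with j
          exact h (n + 1) (M.past n (Preorder.frestrictLe n ω), j)
      _ = l * ∫⁻ ω, M.multReward e ξ n ω ∂(M.law i π₁ π₂) := lintegral_const_mul _ hm
      _ ≤ l * (l ^ (n + 1) * ξ i) := by gcongr
      _ = l ^ (n + 1 + 1) * ξ i := by ring

/-- Both policies give full mass to the admissible actions, so restricting them to the subtypes
loses nothing. This turns stage integrals into iterated integrals over `actA i` and `actB i`. -/
theorem actionKernel_eq_map (π₁ : M.Policy₁) (π₂ : M.Policy₂) (n : ℕ) (h : M.Hist n) :
    M.actionKernel π₁ π₂ n h =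
      (((π₁.ker n h).comap Subtype.val : Measure (M.actA h.2)).prod
        ((π₂.ker n h).comap Subtype.val : Measure (M.actB h.2))).map
          (fun q => M.triple h.2 q.1 q.2) := by
  have := π₁.isMarkovKernel_ker n
  have := π₂.isMarkovKernel_ker n
  have hA := MeasurableEmbedding.subtype_coe (M.measurableSet_actA h.2)
  have hB := MeasurableEmbedding.subtype_coe (M.measurableSet_actB h.2)
  have mA : ((π₁.ker n h).comap Subtype.val : Measure (M.actA h.2)).map Subtype.val =
      π₁.ker n h := by
    rw [hA.map_comap, Subtype.range_coe_subtype]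
    exact Measure.restrict_eq_self_of_ae_mem
      ((prob_compl_eq_zero_iff (M.measurableSet_actA h.2)).2 (π₁.ker_act n h))
  have mB : ((π₂.ker n h).comap Subtype.val : Measure (M.actB h.2)).map Subtype.val =
      π₂.ker n h := by
    rw [hB.map_comap, Subtype.range_coe_subtype]
    exact Measure.restrict_eq_self_of_ae_mem
      ((prob_compl_eq_zero_iff (M.measurableSet_actB h.2)).2 (π₂.ker_act n h))
  have hpA : IsProbabilityMeasure ((π₁.ker n h).comap Subtype.val : Measure (M.actA h.2)) :=
    ⟨by rw [hA.comap_apply, Set.image_univ, Subtype.range_coe, π₁.ker_act]⟩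
  have hpB : IsProbabilityMeasure ((π₂.ker n h).comap Subtype.val : Measure (M.actB h.2)) :=
    ⟨by rw [hB.comap_apply, Set.image_univ, Subtype.range_coe, π₂.ker_act]⟩
  have ht : Measurable fun q : M.actA h.2 × M.actB h.2 => M.triple h.2 q.1 q.2 :=
    Measurable.subtype_mk (by fun_prop)
  unfold actionKernel
  rw [Kernel.comapRight_apply, Kernel.prod_apply, Kernel.prod_apply, Kernel.deterministic_apply]
  conv_lhs => rw [← mA, ← mB]
  rw [Measure.map_prod_map _ _ (by fun_prop) (by fun_prop), Measure.dirac_prod,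
    Measure.map_map (by fun_prop) (by fun_prop)]
  have : ((Prod.mk h.2) ∘ Prod.map Subtype.val Subtype.val :
      M.actA h.2 × M.actB h.2 → S × A × B) =
      Subtype.val ∘ (fun q => M.triple h.2 q.1 q.2) := rfl
  rw [this, ← Measure.map_map (by fun_prop) ht, M.measurableEmbedding_val.comap_map]

end Reward

end SemiMarkovGame

/-! ### From one-step inequalities to bounds on the average cost. -/

theorem tendsto_log_const_mul_pow {θ c l : ℝ} (hθ : 0 < θ) (hc : 0 < c) (hl : 0 < l) :
    Tendsto (fun n : ℕ => ((1 / (θ * n) * Real.log (c * l ^ n) : ℝ) : EReal)) atTop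
      (nhds ((Real.log l / θ : ℝ) : EReal)) := by
  refine (continuous_coe_real_ereal.tendsto _).comp ?_
  have h : Tendsto (fun n : ℕ => Real.log l / θ + (Real.log c / θ) * ((n : ℝ))⁻¹) atTop
      (nhds (Real.log l / θ + (Real.log c / θ) * 0)) :=
    tendsto_const_nhds.add (tendsto_const_nhds.mul tendsto_inv_atTop_nhds_zero_nat)
  rw [mul_zero, add_zero] at h
  refine h.congr' ?_
  filter_upwards [eventually_gt_atTop 0] with n hn
  have hn' : (n : ℝ) ≠ 0 := by positivity
  rw [Real.log_mul hc.ne' (pow_ne_zero _ hl.ne'), Real.log_pow]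
  field_simp
  ring

namespace SemiMarkovGame

section Cost

variable {S A B : Type*} [Fintype S] [MeasurableSpace S]
  [MeasurableSingletonClass S] [MeasurableSpace A] [MeasurableSpace B] (M : SemiMarkovGame S A B)

theorem integrable_exp_sum {θ : ℝ} {D : M.K → ℝ} (hD : Measurable D) {C : ℝ}
    (hC : ∀ k, |D k| ≤ C) (i : S) (π₁ : M.Policy₁) (π₂ : M.Policy₂) (n : ℕ) :
    Integrable (fun ω => Real.exp (θ * ∑ k ∈ Finset.range n, D (ω k).1)) (M.law i π₁ π₂) := by
  refine Integrable.of_bound (Measurable.aestronglyMeasurable (by fun_prop))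
    (Real.exp (|θ| * (n * C))) (Eventually.of_forall fun ω => ?_)
  rw [Real.norm_eq_abs, Real.abs_exp, Real.exp_le_exp]
  refine (le_abs_self _).trans ?_
  rw [abs_mul]
  refine mul_le_mul_of_nonneg_left ((Finset.abs_sum_le_sum_abs _ _).trans ?_) (abs_nonneg _)
  calc ∑ k ∈ Finset.range n, |D (ω k).1| ≤ ∑ _k ∈ Finset.range n, C :=
        Finset.sum_le_sum fun k _ => hC _
    _ = n * C := by simp

theorem ofReal_integral_exp_sum {θ : ℝ} {D : M.K → ℝ} (hD : Measurable D) {C : ℝ}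
    (hC : ∀ k, |D k| ≤ C) (i : S) (π₁ : M.Policy₁) (π₂ : M.Policy₂) (n : ℕ) :
    ENNReal.ofReal (∫ ω, Real.exp (θ * ∑ k ∈ Finset.range n, D (ω k).1) ∂(M.law i π₁ π₂)) =
      ∫⁻ ω, ∏ k ∈ Finset.range n, ENNReal.ofReal (Real.exp (θ * D (ω k).1))
        ∂(M.law i π₁ π₂) := by
  rw [ofReal_integral_eq_lintegral_ofReal (M.integrable_exp_sum hD hC i π₁ π₂ n)
    (Eventually.of_forall fun ω => (Real.exp_pos _).le)]
  refine lintegral_congr fun ω => ?_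
  rw [Finset.mul_sum, Real.exp_sum, ENNReal.ofReal_prod_of_nonneg fun _ _ => (Real.exp_pos _).le]

/-- Integral, against the law of the next state, of a function on the state space. -/
theorem lintegral_p_ofReal (k : M.K) {x : S → ℝ} (hx : ∀ i, 0 ≤ x i) :
    ∫⁻ j, ENNReal.ofReal (x j) ∂(M.p k) = ENNReal.ofReal (∑ j, x j * M.prob k j) := by
  have := M.isMarkovKernel_p
  rw [lintegral_fintype, ENNReal.ofReal_sum_of_nonneg (f := fun j => x j * M.prob k j)
    fun j _ => mul_nonneg (hx j) measureReal_nonneg]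
  refine Finset.sum_congr rfl fun j _ => ?_
  rw [ENNReal.ofReal_mul (hx j), prob, ofReal_measureReal]

/-- Bounding the terminal factor by `max x` gives an expectation of at least `(x i / max x) * l ^
n`, and the constant disappears in the limit. -/
theorem log_div_le_avgCost {θ : ℝ} (hθ : 0 < θ) {D : M.K → ℝ} (hD : Measurable D) {C : ℝ}
    (hC : ∀ k, |D k| ≤ C) {x : S → ℝ} {l : ℝ} (hx : ∀ i, 0 < x i) (hl : 0 < l)
    (π₁ : M.Policy₁) (π₂ : M.Policy₂)
    (h : ∀ n (h : M.Hist n), ENNReal.ofReal (l * x h.2) ≤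
      ∫⁻ k, ENNReal.ofReal (Real.exp (θ * D k) * ∑ j, x j * M.prob k j)
        ∂(M.actionKernel π₁ π₂ n h)) (i : S) :
    ((Real.log l / θ : ℝ) : EReal) ≤ M.avgCost θ D i π₁ π₂ := by
  have hp := M.isMarkovKernel_p
  have : Nonempty S := ⟨i⟩
  obtain ⟨i₁, hi₁⟩ := Finite.exists_max x
  have hx0 : ∀ i, 0 ≤ x i := fun i => (hx i).le
  have hc : 0 < x i / x i₁ := div_pos (hx i) (hx i₁)
  rw [← (tendsto_log_const_mul_pow hθ hc hl).limsup_eq]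
  refine limsup_le_limsup ?_
  filter_upwards [eventually_gt_atTop 0] with n hn
  rw [EReal.coe_le_coe_iff]
  refine mul_le_mul_of_nonneg_left (Real.log_le_log (by positivity) ?_) (by positivity)
  obtain ⟨n, rfl⟩ := Nat.exists_eq_succ_of_ne_zero hn.ne'
  have he : Measurable fun k : M.K => ENNReal.ofReal (Real.exp (θ * D k)) := by fun_prop
  have key := M.le_lintegral_multReward i π₁ π₂ he (fun j => ENNReal.ofReal (x j))
    (l := ENNReal.ofReal l) (fun n h' => by
      rw [← ENNReal.ofReal_mul hl.le]
      refine (h n h').trans_eq (lintegral_congr fun k => ?_)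
      rw [M.lintegral_p_ofReal k hx0, ENNReal.ofReal_mul (Real.exp_pos _).le]) n
  have hle : ∫⁻ ω, M.multReward (fun k => ENNReal.ofReal (Real.exp (θ * D k)))
        (fun j => ENNReal.ofReal (x j)) n ω ∂(M.law i π₁ π₂) ≤
      ENNReal.ofReal (∫ ω, Real.exp (θ * ∑ k ∈ Finset.range (n + 1), D (ω k).1)
        ∂(M.law i π₁ π₂)) * ENNReal.ofReal (x i₁) := by
    rw [M.ofReal_integral_exp_sum hD hC, ← lintegral_mul_const _
      (Finset.measurable_fun_prod _ fun k _ => by fun_prop)]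
    refine lintegral_mono fun ω => mul_le_mul_right ?_ _
    calc _ ≤ ∫⁻ _, ENNReal.ofReal (x i₁) ∂(M.p (ω n).1) :=
          lintegral_mono fun j => ENNReal.ofReal_le_ofReal (hi₁ j)
      _ = _ := by simp
  have hE : 0 ≤ ∫ ω, Real.exp (θ * ∑ k ∈ Finset.range (n + 1), D (ω k).1) ∂(M.law i π₁ π₂) :=
    integral_nonneg fun _ => (Real.exp_pos _).le
  have := key.trans hle
  rw [← ENNReal.ofReal_pow hl.le, ← ENNReal.ofReal_mul (by positivity), ← ENNReal.ofReal_mul hE,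
    ENNReal.ofReal_le_ofReal_iff (mul_nonneg hE (hx0 _))] at this
  rw [div_mul_eq_mul_div, div_le_iff₀ (hx i₁), mul_comm]
  exact this

/-- Here the terminal factor is bounded below by `min x > 0`. -/
theorem avgCost_le_log_div {θ : ℝ} (hθ : 0 < θ) {D : M.K → ℝ} (hD : Measurable D) {C : ℝ}
    (hC : ∀ k, |D k| ≤ C) {x : S → ℝ} {l : ℝ} (hx : ∀ i, 0 < x i) (hl : 0 < l)
    (π₁ : M.Policy₁) (π₂ : M.Policy₂)
    (h : ∀ n (h : M.Hist n), ∫⁻ k, ENNReal.ofReal (Real.exp (θ * D k) * ∑ j, x j * M.prob k j)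
        ∂(M.actionKernel π₁ π₂ n h) ≤ ENNReal.ofReal (l * x h.2)) (i : S) :
    M.avgCost θ D i π₁ π₂ ≤ ((Real.log l / θ : ℝ) : EReal) := by
  have hp := M.isMarkovKernel_p
  have : Nonempty S := ⟨i⟩
  obtain ⟨i₁, hi₁⟩ := Finite.exists_min x
  have hx0 : ∀ i, 0 ≤ x i := fun i => (hx i).le
  have hc : 0 < x i / x i₁ := div_pos (hx i) (hx i₁)
  rw [← (tendsto_log_const_mul_pow hθ hc hl).limsup_eq]
  refine limsup_le_limsup ?_
  filter_upwards [eventually_gt_atTop 0] with n hn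
  rw [EReal.coe_le_coe_iff]
  obtain ⟨n, rfl⟩ := Nat.exists_eq_succ_of_ne_zero hn.ne'
  have he : Measurable fun k : M.K => ENNReal.ofReal (Real.exp (θ * D k)) := by fun_prop
  have key := M.lintegral_multReward_le i π₁ π₂ he (fun j => ENNReal.ofReal (x j))
    (l := ENNReal.ofReal l) (fun n h' => by
      rw [← ENNReal.ofReal_mul hl.le]
      refine (lintegral_congr fun k => ?_).trans_le (h n h')
      rw [M.lintegral_p_ofReal k hx0, ENNReal.ofReal_mul (Real.exp_pos _).le]) n
  have hle : ENNReal.ofReal (∫ ω, Real.exp (θ * ∑ k ∈ Finset.range (n + 1), D (ω k).1)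
        ∂(M.law i π₁ π₂)) * ENNReal.ofReal (x i₁) ≤
      ∫⁻ ω, M.multReward (fun k => ENNReal.ofReal (Real.exp (θ * D k)))
        (fun j => ENNReal.ofReal (x j)) n ω ∂(M.law i π₁ π₂) := by
    rw [M.ofReal_integral_exp_sum hD hC, ← lintegral_mul_const _
      (Finset.measurable_fun_prod _ fun k _ => by fun_prop)]
    refine lintegral_mono fun ω => mul_le_mul_right ?_ _
    calc _ = ∫⁻ _, ENNReal.ofReal (x i₁) ∂(M.p (ω n).1) := by simp
      _ ≤ _ := lintegral_mono fun j => ENNReal.ofReal_le_ofReal (hi₁ j)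
  have hint : Integrable (fun ω => Real.exp (θ * ∑ k ∈ Finset.range (n + 1), D (ω k).1))
      (M.law i π₁ π₂) := M.integrable_exp_sum hD hC i π₁ π₂ (n + 1)
  have hE : 0 < ∫ ω, Real.exp (θ * ∑ k ∈ Finset.range (n + 1), D (ω k).1) ∂(M.law i π₁ π₂) :=
    integral_exp_pos hint
  have := hle.trans key
  rw [← ENNReal.ofReal_pow hl.le, ← ENNReal.ofReal_mul hE.le, ← ENNReal.ofReal_mul (pow_nonneg hl.le _),
    ENNReal.ofReal_le_ofReal_iff (mul_nonneg (pow_nonneg hl.le _) (hx0 _))] at this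
  refine mul_le_mul_of_nonneg_left (Real.log_le_log hE ?_) (by positivity)
  rw [div_mul_eq_mul_div, le_div_iff₀ (hx i₁), mul_comm (x i)]
  exact this

end Cost

end SemiMarkovGame

/-! ### The multiplicative Poisson equation. -/

theorem continuous_integral_prodMk {X Y : Type*} [TopologicalSpace X] [FirstCountableTopology X]
    [TopologicalSpace Y] [SecondCountableTopology Y] [MeasurableSpace Y] [OpensMeasurableSpace Y]
    (ν : Measure Y) [IsFiniteMeasure ν] {f : X × Y → ℝ} (hf : Continuous f) {C : ℝ}
    (hC : ∀ z, |f z| ≤ C) : Continuous fun x => ∫ y, f (x, y) ∂ν :=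
  continuous_of_dominated (bound := fun _ => C)
    (fun x => (hf.comp (Continuous.prodMk_right x)).aestronglyMeasurable)
    (fun x => Eventually.of_forall fun y => hC (x, y)) (integrable_const C)
    (Eventually.of_forall fun y => hf.comp (Continuous.prodMk_left y))

theorem integrable_of_continuous_of_abs_le {Y : Type*} [TopologicalSpace Y]
    [SecondCountableTopology Y] [MeasurableSpace Y] [OpensMeasurableSpace Y]
    (ν : Measure Y) [IsFiniteMeasure ν] {f : Y → ℝ} (hf : Continuous f) {C : ℝ}
    (hC : ∀ y, |f y| ≤ C) : Integrable f ν :=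
  Integrable.of_bound hf.aestronglyMeasurable C (Eventually.of_forall hC)

/-- The multiplicative Poisson equation of a risk-sensitive controlled chain whose controller uses
the actions `X i` in state `i`, while exogenous noise with law `ν i` on `Y i` is integrated out. -/
theorem exists_multiplicative_poisson {S : Type*} [Fintype S] [Nonempty S] {X Y : S → Type*}
    [∀ i, TopologicalSpace (X i)] [∀ i, CompactSpace (X i)] [∀ i, Nonempty (X i)]
    [∀ i, FirstCountableTopology (X i)] [∀ i, SecondCountableTopology (X i)]
    [∀ i, MeasurableSpace (X i)]
    [∀ i, OpensMeasurableSpace (X i)]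
    [∀ i, TopologicalSpace (Y i)] [∀ i, SecondCountableTopology (Y i)]
    [∀ i, MeasurableSpace (Y i)] [∀ i, OpensMeasurableSpace (Y i)]
    (ν : ∀ i, Measure (Y i)) [∀ i, IsProbabilityMeasure (ν i)] {θ C : ℝ} (hθ : 0 < θ)
    {D : ∀ i, X i × Y i → ℝ} (hD : ∀ i, Continuous (D i)) (hC : ∀ i z, |D i z| ≤ C)
    {P : ∀ i, X i × Y i → S → ℝ} (hP : ∀ i j, Continuous fun z => P i z j)
    (hP0 : ∀ i z j, 0 ≤ P i z j) (hP1 : ∀ i z j, P i z j ≤ 1)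
    (hirr : ∀ g : ∀ i, X i,
      (Matrix.of fun i j => ∫ y, P i (g i, y) j ∂(ν i)).IsIrreducible) :
    ∃ (x : S → ℝ) (l : ℝ) (g : ∀ i, X i), (∀ i, 0 < x i) ∧ 0 < l ∧
      (∀ i, ∫ y, Real.exp (θ * D i (g i, y)) * ∑ j, x j * P i (g i, y) j ∂(ν i) = l * x i) ∧
      (∀ i a, l * x i ≤ ∫ y, Real.exp (θ * D i (a, y)) * ∑ j, x j * P i (a, y) j ∂(ν i)) ∧
      ∀ i, l * x i = ⨅ ψ : ProbabilityMeasure (X i),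
        ∫ a, ∫ y, Real.exp (θ * D i (a, y)) * ∑ j, x j * P i (a, y) j ∂(ν i)
          ∂(ψ : Measure (X i)) := by
  have hexp : ∀ i z, Real.exp (θ * D i z) ≤ Real.exp (θ * C) := fun i z =>
    Real.exp_le_exp.2 (mul_le_mul_of_nonneg_left ((le_abs_self _).trans (hC i z)) hθ.le)
  have hcont : ∀ i j, Continuous fun z => Real.exp (θ * D i z) * P i z j := fun i j =>
    (Real.continuous_exp.comp (continuous_const.mul (hD i))).mul (hP i j)
  have hbd : ∀ i j z, |Real.exp (θ * D i z) * P i z j| ≤ Real.exp (θ * C) := fun i j z => by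
    rw [abs_of_nonneg (mul_nonneg (Real.exp_pos _).le (hP0 i z j))]
    exact (mul_le_mul (hexp i z) (hP1 i z j) (hP0 i z j) (Real.exp_pos _).le).trans_eq (mul_one _)
  have hint : ∀ i j a, Integrable (fun y => Real.exp (θ * D i (a, y)) * P i (a, y) j) (ν i) :=
    fun i j a => integrable_of_continuous_of_abs_le _
      ((hcont i j).comp (Continuous.prodMk_right a)) fun y => hbd i j (a, y)
  set q : ∀ i, X i → S → ℝ := fun i a j =>
    ∫ y, Real.exp (θ * D i (a, y)) * P i (a, y) j ∂(ν i) with hq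
  have hqc : ∀ i j, Continuous fun a => q i a j := fun i j =>
    continuous_integral_prodMk (ν i) (hcont i j) (hbd i j)
  -- Since `D ≥ -C`, the weighted matrix dominates `exp (-(θ * C))` times the unweighted one.
  obtain ⟨x, l, g, hx, hl, heq, hle⟩ := exists_pos_eigenvector_min q hqc fun g =>
    (hirr g).of_smul_le (Real.exp_pos (-(θ * C))) fun i j => by
      simp only [Matrix.of_apply, hq]
      rw [← integral_const_mul]
      refine integral_mono (Integrable.const_mul (integrable_of_continuous_of_abs_le _
        ((hP i j).comp (Continuous.prodMk_right (g i))) (C := 1) fun y => ?_) _)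
        (hint i j (g i)) fun y => mul_le_mul_of_nonneg_right ?_ (hP0 i _ j)
      · exact (abs_of_nonneg (hP0 i _ j)).trans_le (hP1 i _ j)
      · rw [Real.exp_le_exp, ← mul_neg]
        exact mul_le_mul_of_nonneg_left (neg_le_of_abs_le (hC i _)) hθ.le
  have hr : ∀ i a, ∫ y, Real.exp (θ * D i (a, y)) * ∑ j, x j * P i (a, y) j ∂(ν i) =
      ∑ j, q i a j * x j := fun i a => by
    simp only [hq, ← integral_mul_const]
    rw [← integral_finsetSum _ fun j _ => (hint i j a).mul_const _]
    refine integral_congr_ae (Eventually.of_forall fun y => ?_)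
    simp only [Finset.mul_sum]
    exact Finset.sum_congr rfl fun j _ => by ring
  refine ⟨x, l, g, hx, hl, fun i => (hr i (g i)).trans (heq i),
    fun i a => (hle i a).trans_eq (hr i a).symm, fun i => ?_⟩
  rw [funext (hr i)]
  have hrc : Continuous fun a => ∑ j, q i a j * x j :=
    continuous_finsetSum _ fun j _ => (hqc i j).mul continuous_const
  have hlow : ∀ ψ : ProbabilityMeasure (X i),
      l * x i ≤ ∫ a, ∑ j, q i a j * x j ∂(ψ : Measure (X i)) := fun ψ => by
    have h1 : ∫ _a, l * x i ∂(ψ : Measure (X i)) = l * x i := by simp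
    rw [← h1]
    refine integral_mono (integrable_const _) ?_ (hle i)
    obtain ⟨c, hc⟩ := (isCompact_univ (X := X i)).exists_bound_of_continuousOn hrc.continuousOn
    exact integrable_of_continuous_of_abs_le _ hrc fun a => hc a trivial
  have : Nonempty (ProbabilityMeasure (X i)) := ⟨⟨Measure.dirac (g i), inferInstance⟩⟩
  -- Every average of values `≥ l * x i` is `≥ l * x i`, and the Dirac mass at `g i` attains it.
  refine le_antisymm (le_ciInf hlow) ?_
  refine (ciInf_le ⟨l * x i, Set.forall_mem_range.2 hlow⟩
    ⟨Measure.dirac (g i), inferInstance⟩).trans_eq ?_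
  rw [ProbabilityMeasure.coe_mk, integral_dirac' _ _ hrc.stronglyMeasurable, heq]

/-! ### Policies as measures on admissible actions. -/

section Policies

variable {S E : Type*} [MeasurableSpace S] [MeasurableSpace E] {act : S → Set E}

theorem Policy.isProbabilityMeasure_comap {K : Type*} [MeasurableSpace K] (π : Policy K act)
    (hact : ∀ i, MeasurableSet (act i)) (n : ℕ) (h : (Fin n → K × Set.Ioi (0 : ℝ)) × S) :
    IsProbabilityMeasure ((π.ker n h).comap Subtype.val : Measure (act h.2)) :=
  ⟨by rw [(MeasurableEmbedding.subtype_coe (hact h.2)).comap_apply, Set.image_univ,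
    Subtype.range_coe, π.ker_act]⟩

theorem StationaryPolicy.isProbabilityMeasure_on (φ : StationaryPolicy act)
    (hact : ∀ i, MeasurableSet (act i)) (i : S) : IsProbabilityMeasure (φ.on i) :=
  ⟨by rw [StationaryPolicy.on, (MeasurableEmbedding.subtype_coe (hact i)).comap_apply,
    Set.image_univ, Subtype.range_coe, φ.ker_act]⟩

theorem StationaryPolicy.nonempty_act (φ : StationaryPolicy act) (i : S) : Nonempty (act i) := by
  rw [Set.nonempty_coe_sort, Set.nonempty_iff_ne_empty]
  intro h
  simpa [h] using φ.ker_act i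

theorem StationaryPolicy.isDiscreteTime_toPolicy (φ : StationaryPolicy act) (K : Type*)
    [MeasurableSpace K] : (φ.toPolicy K).IsDiscreteTime := fun _ h h' _ h2 => by
  simp [StationaryPolicy.toPolicy, Kernel.comap_apply, h2]

variable [Finite S] [MeasurableSingletonClass S]

/-- The stationary policy that always plays the action `g i` in state `i`. -/
noncomputable def StationaryPolicy.dirac (g : ∀ i, act i) (hact : ∀ i, MeasurableSet (act i)) :
    StationaryPolicy act where
  ker := Kernel.deterministic (fun i => (g i : E)) (measurable_of_finite _)
  isMarkovKernel_ker := inferInstance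
  ker_act i := by
    rw [Kernel.deterministic_apply, Measure.dirac_apply' _ (hact i)]
    simp

theorem StationaryPolicy.on_dirac (g : ∀ i, act i) (hact : ∀ i, MeasurableSet (act i)) (i : S) :
    (StationaryPolicy.dirac g hact).on i = Measure.dirac (g i) := by
  have he := MeasurableEmbedding.subtype_coe (hact i)
  rw [StationaryPolicy.on, StationaryPolicy.dirac, Kernel.deterministic_apply,
    ← Measure.map_dirac' he.measurable, he.comap_map]

end Policies

/-! ### Optimality equation and value for each player. -/

namespace SemiMarkovGame

theorem prob_le_one {S A B : Type*} [MeasurableSpace S] [MeasurableSpace A] [MeasurableSpace B]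
    (M : SemiMarkovGame S A B) (k : M.K) (j : S) : M.prob k j ≤ 1 := by
  have := M.isMarkovKernel_p
  exact measureReal_le_one

section Continuity

variable {S A B : Type*} [TopologicalSpace S] [MeasurableSpace S] [TopologicalSpace A]
  [MeasurableSpace A] [TopologicalSpace B] [MeasurableSpace B] (M : SemiMarkovGame S A B)

theorem continuous_triple (i : S) :
    Continuous fun q : M.actA i × M.actB i => M.triple i q.1 q.2 :=
  Continuous.subtype_mk (by fun_prop) _

theorem continuous_exp_mul_sum [Fintype S] {M : SemiMarkovGame S A B}
    (hM : M.CompactContinuous) (θ : ℝ) (D : M.K →ᵇ ℝ) (x : S → ℝ) :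
    Continuous fun k => Real.exp (θ * D k) * ∑ j, x j * M.prob k j :=
  (Real.continuous_exp.comp (continuous_const.mul D.continuous)).mul
    (continuous_finsetSum _ fun j _ => continuous_const.mul (hM.continuous_prob j))

theorem exists_abs_exp_mul_sum_le [Fintype S] {θ : ℝ} (hθ : 0 < θ) (D : M.K →ᵇ ℝ) {x : S → ℝ}
    (hx : ∀ i, 0 < x i) :
    ∃ C, ∀ k, |Real.exp (θ * D k) * ∑ j, x j * M.prob k j| ≤ C := by
  refine ⟨Real.exp (θ * ‖D‖) * ∑ j, x j, fun k => ?_⟩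
  have h0 : ∀ j, 0 ≤ x j * M.prob k j := fun j => mul_nonneg (hx j).le measureReal_nonneg
  rw [abs_of_nonneg (mul_nonneg (Real.exp_pos _).le (Finset.sum_nonneg fun j _ => h0 j))]
  refine mul_le_mul (Real.exp_le_exp.2 (mul_le_mul_of_nonneg_left
    ((le_abs_self _).trans (D.norm_coe_le_norm k)) hθ.le)) (Finset.sum_le_sum fun j _ => ?_)
    (Finset.sum_nonneg fun j _ => h0 j) (Real.exp_pos _).le
  exact mul_le_of_le_one_right (hx j).le (M.prob_le_one k j)

end Continuity

section Poisson

variable {S A B : Type*} [Fintype S] [TopologicalSpace S] [DiscreteTopology S]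
  [MeasurableSpace S] [BorelSpace S]
  [TopologicalSpace A] [SecondCountableTopology A]
  [MeasurableSpace A] [BorelSpace A]
  [TopologicalSpace B] [SecondCountableTopology B]
  [MeasurableSpace B] [BorelSpace B]
  (M : SemiMarkovGame S A B)

/-- The optimality equation and the value of player 1 against a stationary policy of player 2. -/
theorem exists_optimality_equation₁ [TopologicalSpace.MetrizableSpace A]
    (hM₁ : M.CompactContinuous) (hM₂ : M.EmbeddedIrreducible)
    {θ : ℝ} (hθ : 0 < θ) (D : M.K →ᵇ ℝ) (φ₁ : M.Stationary₁) (φ₂ : M.Stationary₂) :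
    ∃ (x : S → ℝ) (l : ℝ), (∀ i, 0 < x i) ∧ 0 < l ∧
      (∀ i, l * x i = ⨅ ψ : ProbabilityMeasure (M.actA i),
        ∫ a, ∫ b, Real.exp (θ * D (M.triple i a b)) * ∑ j, x j * M.prob (M.triple i a b) j
          ∂(φ₂.on i) ∂(ψ : Measure (M.actA i))) ∧
      ∀ i, ((Real.log l / θ : ℝ) : EReal) = ⨅ π₁ : {π : M.Policy₁ // π.IsDiscreteTime},
        M.avgCost θ D i π₁ (φ₂.toPolicy M.K) := by
  rcases isEmpty_or_nonempty S with hS | hS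
  -- The simplex is empty when `S` is; the claims are then vacuous.
  · exact ⟨fun _ => 1, 1, fun _ => one_pos, one_pos, isEmptyElim, isEmptyElim⟩
  have hcA : ∀ i, CompactSpace (M.actA i) := fun i =>
    isCompact_iff_compactSpace.1 (hM₁.isCompact_actA i)
  have hnA : ∀ i, Nonempty (M.actA i) := φ₁.nonempty_act
  have hpr : ∀ i, IsProbabilityMeasure (φ₂.on i) :=
    φ₂.isProbabilityMeasure_on M.measurableSet_actB
  obtain ⟨x, l, g, hx, hl, heq, hle, hinf⟩ := exists_multiplicative_poisson
    (X := fun i => M.actA i) (Y := fun i => M.actB i) (fun i => φ₂.on i) (C := ‖D‖) hθ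
    (D := fun i q => D (M.triple i q.1 q.2)) (fun i => D.continuous.comp (M.continuous_triple i))
    (fun i q => D.norm_coe_le_norm _) (P := fun i q j => M.prob (M.triple i q.1 q.2) j)
    (fun i j => (hM₁.continuous_prob j).comp (M.continuous_triple i))
    (fun i q j => measureReal_nonneg) (fun i q j => M.prob_le_one _ j) (fun g => by
      convert hM₂ (StationaryPolicy.dirac g M.measurableSet_actA) φ₂ using 1
      ext i j
      simp only [transitionMatrix, Matrix.of_apply, StationaryPolicy.on_dirac, integral_dirac])
  refine ⟨x, l, hx, hl, hinf, fun i => ?_⟩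
  have hGc := continuous_exp_mul_sum hM₁ θ D x
  obtain ⟨C, hC⟩ := M.exists_abs_exp_mul_sum_le hθ D hx
  set G : M.K → ℝ := fun k => Real.exp (θ * D k) * ∑ j, x j * M.prob k j with hG
  have hG0 : ∀ k, 0 ≤ G k := fun k => mul_nonneg (Real.exp_pos _).le
    (Finset.sum_nonneg fun j _ => mul_nonneg (hx j).le measureReal_nonneg)
  have hlint : ∀ i a, ∫⁻ b, ENNReal.ofReal (G (M.triple i a b)) ∂(φ₂.on i) =
      ENNReal.ofReal (∫ b, G (M.triple i a b) ∂(φ₂.on i)) := fun i a =>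
    (ofReal_integral_eq_lintegral_ofReal (integrable_of_continuous_of_abs_le _
      (hGc.comp ((M.continuous_triple i).comp (Continuous.prodMk_right a))) fun b => hC _)
      (Eventually.of_forall fun b => hG0 _)).symm
  have hact : ∀ (π : M.Policy₁) n (h : M.Hist n),
      ∫⁻ k, ENNReal.ofReal (G k) ∂(M.actionKernel π (φ₂.toPolicy M.K) n h) =
        ∫⁻ a, ENNReal.ofReal (∫ b, G (M.triple h.2 a b) ∂(φ₂.on h.2))
          ∂((π.ker n h).comap Subtype.val : Measure (M.actA h.2)) := fun π n h => by
    have hGm : Measurable fun k => ENNReal.ofReal (G k) := hGc.measurable.ennreal_ofReal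
    have ht := (M.continuous_triple h.2).measurable
    rw [M.actionKernel_eq_map, lintegral_map hGm ht]
    change ∫⁻ q, _ ∂(Measure.prod _ (φ₂.on h.2)) = _
    exact (lintegral_prod _ (hGm.comp ht).aemeasurable).trans
      (lintegral_congr fun a => hlint h.2 a)
  -- The lower bound works for any policy; the Dirac policy at the minimizing actions attains it and
  -- ignores the sojourn times.
  refine le_antisymm (le_iInf fun π => ?_) ?_
  · refine M.log_div_le_avgCost hθ D.continuous.measurable D.norm_coe_le_norm hx hl _ _
      (fun n h => ?_) i
    have := π.1.isProbabilityMeasure_comap M.measurableSet_actA n h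
    rw [hact]
    calc ENNReal.ofReal (l * x h.2) = ∫⁻ _, ENNReal.ofReal (l * x h.2)
          ∂((π.1.ker n h).comap Subtype.val : Measure (M.actA h.2)) := by simp
      _ ≤ _ := lintegral_mono fun a => ENNReal.ofReal_le_ofReal (hle h.2 a)
  · set γ := StationaryPolicy.dirac g M.measurableSet_actA with hγ
    refine (iInf_le _ ⟨γ.toPolicy M.K, γ.isDiscreteTime_toPolicy M.K⟩).trans ?_
    refine M.avgCost_le_log_div hθ D.continuous.measurable D.norm_coe_le_norm hx hl _ _
      (fun n h => ?_) i
    rw [hact]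
    change ∫⁻ a, _ ∂(γ.on h.2) ≤ _
    rw [hγ, StationaryPolicy.on_dirac, lintegral_dirac]
    exact ENNReal.ofReal_le_ofReal (heq h.2).le

/-- The optimality equation and the value of player 2 against a stationary policy of player 1. -/
theorem exists_optimality_equation₂ [TopologicalSpace.MetrizableSpace B]
    (hM₁ : M.CompactContinuous) (hM₂ : M.EmbeddedIrreducible)
    {θ : ℝ} (hθ : 0 < θ) (D : M.K →ᵇ ℝ) (φ₁ : M.Stationary₁) (φ₂ : M.Stationary₂) :
    ∃ (x : S → ℝ) (l : ℝ), (∀ i, 0 < x i) ∧ 0 < l ∧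
      (∀ i, l * x i = ⨅ ξ : ProbabilityMeasure (M.actB i),
        ∫ a, ∫ b, Real.exp (θ * D (M.triple i a b)) * ∑ j, x j * M.prob (M.triple i a b) j
          ∂(ξ : Measure (M.actB i)) ∂(φ₁.on i)) ∧
      ∀ i, ((Real.log l / θ : ℝ) : EReal) = ⨅ π₂ : {π : M.Policy₂ // π.IsDiscreteTime},
        M.avgCost θ D i (φ₁.toPolicy M.K) π₂ := by
  rcases isEmpty_or_nonempty S with hS | hS
  · exact ⟨fun _ => 1, 1, fun _ => one_pos, one_pos, isEmptyElim, isEmptyElim⟩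
  have hcB : ∀ i, CompactSpace (M.actB i) := fun i =>
    isCompact_iff_compactSpace.1 (hM₁.isCompact_actB i)
  have hnB : ∀ i, Nonempty (M.actB i) := φ₂.nonempty_act
  have hpr : ∀ i, IsProbabilityMeasure (φ₁.on i) :=
    φ₁.isProbabilityMeasure_on M.measurableSet_actA
  have hts : ∀ i, Continuous fun q : M.actB i × M.actA i => M.triple i q.2 q.1 := fun i =>
    (M.continuous_triple i).comp continuous_swap
  obtain ⟨x, l, g, hx, hl, heq, hle, hinf⟩ := exists_multiplicative_poisson
    (X := fun i => M.actB i) (Y := fun i => M.actA i) (fun i => φ₁.on i) (C := ‖D‖) hθ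
    (D := fun i q => D (M.triple i q.2 q.1)) (fun i => D.continuous.comp (hts i))
    (fun i q => D.norm_coe_le_norm _) (P := fun i q j => M.prob (M.triple i q.2 q.1) j)
    (fun i j => (hM₁.continuous_prob j).comp (hts i))
    (fun i q j => measureReal_nonneg) (fun i q j => M.prob_le_one _ j) (fun g => by
      convert hM₂ φ₁ (StationaryPolicy.dirac g M.measurableSet_actB) using 1
      ext i j
      simp only [transitionMatrix, Matrix.of_apply, StationaryPolicy.on_dirac, integral_dirac])
  have hGc := continuous_exp_mul_sum hM₁ θ D x
  obtain ⟨C, hC⟩ := M.exists_abs_exp_mul_sum_le hθ D hx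
  refine ⟨x, l, hx, hl, fun i => (hinf i).trans (iInf_congr fun ξ => ?_), fun i => ?_⟩
  -- The Poisson equation has the controller's integral outermost, here over `b`; Fubini restores
  -- the stated order.
  · exact integral_integral_swap (integrable_of_continuous_of_abs_le _ (hGc.comp (hts i))
      fun q => hC _)
  set G : M.K → ℝ := fun k => Real.exp (θ * D k) * ∑ j, x j * M.prob k j with hG
  have hG0 : ∀ k, 0 ≤ G k := fun k => mul_nonneg (Real.exp_pos _).le
    (Finset.sum_nonneg fun j _ => mul_nonneg (hx j).le measureReal_nonneg)
  have hlint : ∀ i b, ∫⁻ a, ENNReal.ofReal (G (M.triple i a b)) ∂(φ₁.on i) =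
      ENNReal.ofReal (∫ a, G (M.triple i a b) ∂(φ₁.on i)) := fun i b =>
    (ofReal_integral_eq_lintegral_ofReal (integrable_of_continuous_of_abs_le _
      (hGc.comp ((hts i).comp (Continuous.prodMk_right b))) fun a => hC _)
      (Eventually.of_forall fun a => hG0 _)).symm
  have hact : ∀ (π : M.Policy₂) n (h : M.Hist n),
      ∫⁻ k, ENNReal.ofReal (G k) ∂(M.actionKernel (φ₁.toPolicy M.K) π n h) =
        ∫⁻ b, ENNReal.ofReal (∫ a, G (M.triple h.2 a b) ∂(φ₁.on h.2))
          ∂((π.ker n h).comap Subtype.val : Measure (M.actB h.2)) := fun π n h => by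
    have := π.isProbabilityMeasure_comap M.measurableSet_actB n h
    have hGm : Measurable fun k => ENNReal.ofReal (G k) := hGc.measurable.ennreal_ofReal
    have ht := (M.continuous_triple h.2).measurable
    rw [M.actionKernel_eq_map, lintegral_map hGm ht]
    change ∫⁻ q, _ ∂(Measure.prod (φ₁.on h.2) _) = _
    exact (lintegral_prod_symm _ (hGm.comp ht).aemeasurable).trans
      (lintegral_congr fun b => hlint h.2 b)
  refine le_antisymm (le_iInf fun π => ?_) ?_
  · refine M.log_div_le_avgCost hθ D.continuous.measurable D.norm_coe_le_norm hx hl _ _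
      (fun n h => ?_) i
    have := π.1.isProbabilityMeasure_comap M.measurableSet_actB n h
    rw [hact]
    calc ENNReal.ofReal (l * x h.2) = ∫⁻ _, ENNReal.ofReal (l * x h.2)
          ∂((π.1.ker n h).comap Subtype.val : Measure (M.actB h.2)) := by simp
      _ ≤ _ := lintegral_mono fun b => ENNReal.ofReal_le_ofReal (hle h.2 b)
  · set γ := StationaryPolicy.dirac g M.measurableSet_actB with hγ
    refine (iInf_le _ ⟨γ.toPolicy M.K, γ.isDiscreteTime_toPolicy M.K⟩).trans ?_
    refine M.avgCost_le_log_div hθ D.continuous.measurable D.norm_coe_le_norm hx hl _ _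
      (fun n h => ?_) i
    rw [hact]
    change ∫⁻ b, _ ∂(γ.on h.2) ≤ _
    rw [hγ, StationaryPolicy.on_dirac, lintegral_dirac]
    exact ENNReal.ofReal_le_ofReal (heq h.2).le

end Poisson

end SemiMarkovGame

theorem mainTheorem6 {S A B : Type*}
    [Fintype S] [TopologicalSpace S] [DiscreteTopology S] [MeasurableSpace S] [BorelSpace S]
    [TopologicalSpace A] [TopologicalSpace.MetrizableSpace A] [SecondCountableTopology A]
    [MeasurableSpace A] [BorelSpace A] [StandardBorelSpace A]
    [TopologicalSpace B] [TopologicalSpace.MetrizableSpace B] [SecondCountableTopology B]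
    [MeasurableSpace B] [BorelSpace B] [StandardBorelSpace B]
    (M : SemiMarkovGame S A B) (hM₁ : M.CompactContinuous) (hM₂ : M.EmbeddedIrreducible)
    (θ : ℝ) (hθ : 0 < θ) (D₁ D₂ : M.K →ᵇ ℝ)
    (φ₁ : M.Stationary₁) (φ₂ : M.Stationary₂) :
    ∃ (y₁ y₂ : S → ℝ) (μ₁ μ₂ : ℝ),
      ((∀ i, Real.exp (θ * y₂ i + θ * μ₂) =
          ⨅ ψ : ProbabilityMeasure (M.actA i), ∫ a, ∫ b, Real.exp (θ * D₁ (M.triple i a b)) *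
            ∑ j, Real.exp (θ * y₂ j) * M.prob (M.triple i a b) j
              ∂(φ₂.on i) ∂(ψ : Measure (M.actA i))) ∧
        ∀ i, (μ₂ : EReal) = ⨅ π₁ : {π : M.Policy₁ // π.IsDiscreteTime},
          M.avgCost θ D₁ i π₁ (φ₂.toPolicy M.K)) ∧
      ((∀ i, Real.exp (θ * y₁ i + θ * μ₁) =
          ⨅ ξ : ProbabilityMeasure (M.actB i), ∫ a, ∫ b, Real.exp (θ * D₂ (M.triple i a b)) *
            ∑ j, Real.exp (θ * y₁ j) * M.prob (M.triple i a b) j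
              ∂(ξ : Measure (M.actB i)) ∂(φ₁.on i)) ∧
        ∀ i, (μ₁ : EReal) = ⨅ π₂ : {π : M.Policy₂ // π.IsDiscreteTime},
          M.avgCost θ D₂ i (φ₁.toPolicy M.K) π₂) := by
  obtain ⟨x₂, l₂, hx₂, hl₂, heq₂, hval₂⟩ :=
    M.exists_optimality_equation₁ hM₁ hM₂ hθ D₁ φ₁ φ₂
  obtain ⟨x₁, l₁, hx₁, hl₁, heq₁, hval₁⟩ :=
    M.exists_optimality_equation₂ hM₁ hM₂ hθ D₂ φ₁ φ₂
  have hexp : ∀ {x : ℝ}, 0 < x → Real.exp (θ * (Real.log x / θ)) = x := fun {x} h => by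
    rw [mul_div_cancel₀ _ hθ.ne', Real.exp_log h]
  -- Undo the substitution `x = exp (θ y)`, `l = exp (θ μ)`.
  refine ⟨fun i => Real.log (x₁ i) / θ, fun i => Real.log (x₂ i) / θ, Real.log l₁ / θ,
    Real.log l₂ / θ, ⟨fun i => ?_, hval₂⟩, ⟨fun i => ?_, hval₁⟩⟩
  · simp only [Real.exp_add, hexp (hx₂ _), hexp hl₂]
    rw [mul_comm, heq₂ i]
  · simp only [Real.exp_add, hexp (hx₁ _), hexp hl₁]
    rw [mul_comm, heq₁ i]
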